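/- Consider the linear convection–diffusion problem $u_t+c\,u_x=b\,u_{xx}$ with constants $c\in\mathbb R$, $b\ge 0$ and periodic boundary conditions on an interval $[x_{\ell},x_r]$, with grid $x_i=x_\ell+i\Delta x$, $0\le i\le N$, $\Delta x=(x_r-x_\ell)/N$, and let $\Delta t>0$. **Quadrature.** For $\alpha>0$ let $c_r$ ($-3\le r\le 2$) be the coefficients of the sixth-order linear rule: $\sum_{r=-3}^{2}c_r v_{i+r}=\alpha\int_{x_{i-1}}^{x_i}e^{-\alpha(x_i-y)}p(y)\,dy$, where $p$ is the polynomial of degree at most $5$ interpolating $v$ at $x_{i-3},\dots,x_{i+2}$. For a periodic grid function $v$ put $J^L_i=\sum_{r=-3}^{2}c_r v_{i+r}$, $J^R_i=\sum_{r=-3}^{2}c_r v_{i-r}$, and $$I^L_0=0,\quad I^L_i=e^{-\alpha\Delta x}I^L_{i-1}+J^L_i,\qquad I^R_N=0,\quad I^R_i=e^{-\alpha\Delta x}I^R_{i+1}+J^R_i,\qquad I^0_i=\tfrac12(I^L_i+I^R_i).$$ With $\mu=e^{-\alpha(x_r-x_\ell)}$ define $$\mathcal D_L[v,\alpha]_i=v_i-I^L_i-\tfrac{I^L_N}{1-\mu}e^{-\alpha(x_i-x_\ell)},\qquad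 \mathcal D_R[v,\alpha]_i=v_i-I^R_i-\tfrac{I^R_0}{1-\mu}e^{-\alpha(x_r-x_i)},$$ $$\mathcal D_0[v,\alpha]_i=v_i-I^0_i-\tfrac{I^0_N}{1-\mu}e^{-\alpha(x_i-x_\ell)}-\tfrac{I^0_0}{1-\mu}e^{-\alpha(x_r-x_i)}.$$ **Scheme.** Let $f^\pm(u)=\frac12(cu\pm|c|u)$, $\alpha_c=\frac{\beta}{|c|\Delta t}$, $\alpha_0=\sqrt{\frac{\beta}{b\Delta t}}$. For $k=1,2$ use the $k$-th partial sum $\mathcal H=\mathcal H_k$, $$\mathcal H_k[u]=-\alpha_c\sum_{p=1}^{k}\mathcal D_L^p[f^+(u),\alpha_c]+\alpha_c\sum_{p=1}^{k}\mathcal D_R^p[f^-(u),\alpha_c]-\alpha_0^2\sum_{p=1}^{k}\mathcal D_0^p[bu,\alpha_0],$$ and for $k=3$ use the modified sum $$\mathcal H[u]=\mathcal H_3[u]+\alpha_c\,\mathcal D_0\big[\mathcal D_L^2[f^+(u),\alpha_c]-\mathcal D_*^2[f^-(u),\alpha_c],\,\alpha_c\big],$$ where $*$ is either $L$ or $R$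 (the result is asserted for both choices). If $c=0$ (resp. $b=0$) the convection terms, including the extra term (resp. the diffusion term), are absent. One time step $u^n\mapsto u^{n+1}$ is, with $E(u)=u+\Delta t\,\mathcal H[u]$, the $k$-th order SSP Runge–Kutta method: - $k=1$: $u^{n+1}=E(u^n)$; - $k=2$: $u^{n+1}=\frac12u^n+\frac12E(E(u^n))$; - $k=3$: $u^{(2)}=\frac34u^n+\frac14E(E(u^n))$, $u^{n+1}=\frac13u^n+\frac23E(u^{(2)})$. **Theorem.** Let $(\beta_{1,k,\max},\beta_{2,k,\max})=(2,2),\ (1,1),\ (1.243,\,0.8375)$ for $k=1,2,3$, and $\beta_{k,\max}=\frac12\min(\beta_{1,k,\max},\beta_{2,k,\max})$, that is $1,\ 0.5,\ 0.41875$. If $k\in\{1,2,3\}$ and $0<\beta\le\beta_{k,\max}$, then the fully discrete scheme is unconditionally stable in the von Neumann sense: for every interval, every $N\ge1$, every $\Delta t>0$ and every wave number $\kappa=2\pi m/(x_r-x_\ell)$, $m\in\mathbb Z$, one time step maps the Fourier mode $u_j=e^{i\kappa x_j}$ to $\lambda u_j$ with an amplification factor $\lambda\in\mathbb C$, $|\lambda|\le1$.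 -/

import Mathlib

open scoped BigOperators

noncomputable section

namespace KernelScheme

/-- Complex-valued periodic grid functions: the grid points are `x_i = x_0 + i h`, `0 ≤ i ≤ N`, and
`x_N` is identified with `x_0`, so that indices live in `ZMod N`. -/
abbrev Grid (N : ℕ) : Type := ZMod N → ℂ

/-- The six nodes (in units of the mesh size, relative to `x_i`) of the stencil
`x_{i-3}, …, x_{i+2}`. -/
def stencil : Finset ℤ := Finset.Icc (-3) 2

/-- The coefficient `c_r` of the sixth order linear quadrature rule: the integral
`α ∫_{x_{i-1}}^{x_i} e^{-α (x_i - y)} ℓ_r(y) dy` (written with `y = x_i + s`), where `ℓ_r` is the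
Lagrange basis polynomial, of degree five, of the node `x_{i+r}` in the six-point stencil. -/
def quadCoeff (α h : ℝ) (r : ℤ) : ℝ :=
  α * ∫ s in (-h)..0,
    Real.exp (α * s) * (Lagrange.basis stencil (fun j : ℤ => (j : ℝ)) r).eval (s / h)

/-- `J^L_i = ∑_{r=-3}^{2} c_r v_{i+r}`. -/
def JL {N : ℕ} (α h : ℝ) (v : Grid N) (i : ZMod N) : ℂ :=
  ∑ r ∈ stencil, (quadCoeff α h r : ℂ) * v (i + (r : ZMod N))

/-- `J^R_i = ∑_{r=-3}^{2} c_r v_{i-r}`. -/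
def JR {N : ℕ} (α h : ℝ) (v : Grid N) (i : ZMod N) : ℂ :=
  ∑ r ∈ stencil, (quadCoeff α h r : ℂ) * v (i - (r : ZMod N))

/-- `I^L_0 = 0`, `I^L_i = e^{-α h} I^L_{i-1} + J^L_i`. -/
def IL {N : ℕ} (α h : ℝ) (v : Grid N) : ℕ → ℂ
  | 0 => 0
  | i + 1 => (Real.exp (-α * h) : ℂ) * IL α h v i + JL α h v ((i + 1 : ℕ) : ZMod N)

/-- The values `I^R_{N-m}`, by recursion on `m`: `I^R_N = 0`,
`I^R_i = e^{-α h} I^R_{i+1} + J^R_i`. -/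
def IRrev {N : ℕ} (α h : ℝ) (v : Grid N) : ℕ → ℂ
  | 0 => 0
  | m + 1 => (Real.exp (-α * h) : ℂ) * IRrev α h v m
      + JR α h v ((N : ZMod N) - ((m + 1 : ℕ) : ZMod N))

/-- `I^R_i`, for `0 ≤ i ≤ N`. -/
def IR {N : ℕ} (α h : ℝ) (v : Grid N) (i : ℕ) : ℂ := IRrev α h v (N - i)

/-- `I^0_i = (I^L_i + I^R_i) / 2`. -/
def I0 {N : ℕ} (α h : ℝ) (v : Grid N) (i : ℕ) : ℂ := (IL α h v i + IR α h v i) / 2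

/-- `μ = e^{-α (x_N - x_0)}`. -/
def mu (N : ℕ) (α h : ℝ) : ℝ := Real.exp (-α * (N * h))

/-- Discrete `L_L⁻¹[v]_i = I^L_i + A_L e^{-α (x_i - x_0)}` with periodic boundary treatment
`A_L = I^L_N / (1 - μ)`. -/
def invL {N : ℕ} (α h : ℝ) (v : Grid N) : Grid N := fun i =>
  IL α h v i.val + IL α h v N / (1 - (mu N α h : ℂ)) * (Real.exp (-α * (i.val * h)) : ℂ)

/-- Discrete `L_R⁻¹[v]_i = I^R_i + B_R e^{-α (x_N - x_i)}` with periodic boundary treatment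
`B_R = I^R_0 / (1 - μ)`. -/
def invR {N : ℕ} (α h : ℝ) (v : Grid N) : Grid N := fun i =>
  IR α h v i.val
    + IR α h v 0 / (1 - (mu N α h : ℂ)) * (Real.exp (-α * (N * h - i.val * h)) : ℂ)

/-- Discrete `L_0⁻¹[v]_i = I^0_i + A_0 e^{-α (x_i - x_0)} + B_0 e^{-α (x_N - x_i)}` with periodic
boundary treatment `A_0 = I^0_N / (1 - μ)`, `B_0 = I^0_0 / (1 - μ)`. -/
def inv0 {N : ℕ} (α h : ℝ) (v : Grid N) : Grid N := fun i =>
  I0 α h v i.val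
    + I0 α h v N / (1 - (mu N α h : ℂ)) * (Real.exp (-α * (i.val * h)) : ℂ)
    + I0 α h v 0 / (1 - (mu N α h : ℂ)) * (Real.exp (-α * (N * h - i.val * h)) : ℂ)

/-- `D_L = I - L_L⁻¹`. -/
def DL {N : ℕ} (α h : ℝ) (v : Grid N) : Grid N := v - invL α h v

/-- `D_R = I - L_R⁻¹`. -/
def DR {N : ℕ} (α h : ℝ) (v : Grid N) : Grid N := v - invR α h v

/-- `D_0 = I - L_0⁻¹`. -/
def D0 {N : ℕ} (α h : ℝ) (v : Grid N) : Grid N := v - inv0 α h v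

/-- `f⁺(u) = (f(u) + |c| u) / 2` for `f(u) = c u`. -/
def fPlus {N : ℕ} (c : ℝ) (u : Grid N) : Grid N := fun i => ((c : ℂ) * u i + (|c| : ℝ) * u i) / 2

/-- `f⁻(u) = (f(u) - |c| u) / 2` for `f(u) = c u`. -/
def fMinus {N : ℕ} (c : ℝ) (u : Grid N) : Grid N := fun i => ((c : ℂ) * u i - (|c| : ℝ) * u i) / 2

/-- `g(u) = b u`. -/
def gDiff {N : ℕ} (b : ℝ) (u : Grid N) : Grid N := fun i => (b : ℂ) * u i

/-- `α_L = α_R = β / (|c| Δt)`. For `c = 0` this is `0`, and so are `f⁺`, `f⁻` and every convection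
term below, as it should be for an equation without convection. -/
def alphaC (c β dt : ℝ) : ℝ := β / (|c| * dt)

/-- `α_0 = √(β / (b Δt))`. For `b = 0` this is `0`, and so are `g` and the diffusion
term below, as it should be for an equation without diffusion. -/
def alphaD (b β dt : ℝ) : ℝ := Real.sqrt (β / (b * dt))

/-- The `k`-th partial sum `H[u]` for `f(u) = c u`, `g(u) = b u`. -/
def partialSum {N : ℕ} (k : ℕ) (c b β dt h : ℝ) (u : Grid N) : Grid N := fun i =>
  -((β / (|c| * dt) : ℝ) : ℂ) *
      ∑ p ∈ Finset.Icc 1 k, (DL (alphaC c β dt) h)^[p] (fPlus c u) i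
    + ((β / (|c| * dt) : ℝ) : ℂ) *
      ∑ p ∈ Finset.Icc 1 k, (DR (alphaC c β dt) h)^[p] (fMinus c u) i
    - ((β / (b * dt) : ℝ) : ℂ) *
      ∑ p ∈ Finset.Icc 1 k, (D0 (alphaD b β dt) h)^[p] (gDiff b u) i

/-- The two sides from which the operator acting on `f⁻` in the extra term of the modified third
partial sum can be taken. -/
inductive Side
  | left
  | right

/-- `D_L` or `D_R`. -/
def DSide {N : ℕ} : Side → ℝ → ℝ → Grid N → Grid N
  | Side.left => DL
  | Side.right => DR

/-- The modified third partial sum: the third partial sum plus the extra term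
`β/(|c|Δt) D_0[ D_L²[f⁺(u)] - D_*²[f⁻(u)] ]`, in which all operators, `D_0` included, are taken
with the parameter `β/(|c|Δt)`, and `* = L` or `* = R`. -/
def modifiedSum {N : ℕ} (s : Side) (c b β dt h : ℝ) (u : Grid N) : Grid N := fun i =>
  partialSum 3 c b β dt h u i
    + ((β / (|c| * dt) : ℝ) : ℂ) *
      D0 (alphaC c β dt) h
        ((DL (alphaC c β dt) h)^[2] (fPlus c u)
          - (DSide s (alphaC c β dt) h)^[2] (fMinus c u)) i

/-- One forward Euler step for `u' = H[u]`. -/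
def euler {N : ℕ} (dt : ℝ) (H : Grid N → Grid N) (u : Grid N) : Grid N := u + (dt : ℂ) • H u

/-- One step of the `k`-th order explicit SSP Runge-Kutta method, `k = 1, 2, 3`
(junk for other `k`). -/
def sspRK {N : ℕ} (k : ℕ) (dt : ℝ) (H : Grid N → Grid N) (u : Grid N) : Grid N :=
  match k with
  | 1 => euler dt H u
  | 2 =>
    let u1 := euler dt H u
    (1 / 2 : ℂ) • u + (1 / 2 : ℂ) • euler dt H u1
  | 3 =>
    let u1 := euler dt H u
    let u2 := (3 / 4 : ℂ) • u + (1 / 4 : ℂ) • euler dt H u1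
    (1 / 3 : ℂ) • u + (2 / 3 : ℂ) • euler dt H u2
  | _ => u

/-- One time step `u^n ↦ u^{n+1}` of the fully discrete scheme of order `k`: the `k`-th order SSP
Runge-Kutta method with the `k`-th partial sum, modified if `k = 3`. -/
def step {N : ℕ} (k : ℕ) (s : Side) (c b β dt h : ℝ) (u : Grid N) : Grid N :=
  sspRK k dt (if k = 3 then modifiedSum s c b β dt h else partialSum k c b β dt h) u

/-- The Fourier mode `u_j = e^{i κ x_j}`, `x_j = xl + j h`, with
`h = (xr - xl) / N` and the wave number `κ = 2 π m / (xr - xl)` of a periodic function. -/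
def mode (N : ℕ) (xl xr : ℝ) (m : ℤ) : Grid N := fun j =>
  Complex.exp (Complex.I * ((2 * Real.pi * m / (xr - xl) : ℝ) : ℂ)
    * ((xl + j.val * ((xr - xl) / N) : ℝ) : ℂ))

/-- Unconditional stability (in the von Neumann sense) of the scheme: on every interval `[xl, xr]`,
for every number `N` of cells and every time step, every Fourier mode is multiplied in one time
step by an amplification factor of modulus at most one. -/
def UnconditionallyStable (k : ℕ) (s : Side) (c b β : ℝ) : Prop :=
  ∀ (xl xr : ℝ), xl < xr → ∀ N : ℕ, 0 < N → ∀ dt : ℝ, 0 < dt → ∀ m : ℤ,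
    ∃ amp : ℂ, step k s c b β dt ((xr - xl) / N) (mode N xl xr m) = amp • mode N xl xr m
      ∧ ‖amp‖ ≤ 1

/-- `β_{1,k,max}` for `k = 1, 2, 3`. -/
def beta1Max : ℕ → ℝ
  | 1 => 2
  | 2 => 1
  | 3 => 1.243
  | _ => 0

/-- `β_{2,k,max}` for `k = 1, 2, 3`. -/
def beta2Max : ℕ → ℝ
  | 1 => 2
  | 2 => 1
  | 3 => 0.8375
  | _ => 0

/-- `β_{k,max} = ½ min(β_{1,k,max}, β_{2,k,max})`. -/
def betaMax (k : ℕ) : ℝ := 1 / 2 * min (beta1Max k) (beta2Max k)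

end KernelScheme

end

/-!
On a Fourier mode with shift factor `w`, `‖w‖ = 1`, every operator of the scheme acts as
multiplication by a number: with the periodic boundary treatment, `L_L⁻¹` is the periodic solution
operator of `x_i = e^{-αh} x_{i-1} + J^L_i`. If `d` is the symbol of `D_L`, then `D_R` has the
symbol `conj d` and `D_0` has `re d` (`IsMode.DL`, `IsMode.DR`, `IsMode.D0`).

The central fact is that `d` lies in the closed disc with diameter `[0, 1]`, whatever the mode, the
mesh and `α` (`symbolD_mem_closedBall`). After centring the stencil at the midpoint of the cell,
this becomes an inequality between the moments `∫ (1/4 - t²)^k e^{νt} dt`, `ν = αh`; expressed in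
the moments with `k = 2, 3`, it is visible from the coefficients (`dissipation_nonneg`).

One time step therefore multiplies a mode by `R(X)`, where `R` is the Taylor polynomial of degree
`k` of the exponential, `X = -β (A + Y)`, `A` is the (modified) partial sum at some `z` in the disc,
and `Y` is the partial sum at some `y ∈ [0, 1]`. Write `X = -2β (A + Y) / 2`. It remains to see that
the midpoint of `A` and `Y`, multiplied by `-2β`, is in the stability region. For `k = 1` this is
the convexity of a disc. For `k = 2` the stability region is a convex Cassini oval
(`convex_cassini`), so that `A` and `Y` can be treated separately. For `k = 3` the part of a
suitable disc that lies in a half plane is a convex part of the stability region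
(`norm_rk3_le_of_mem`), and it is large enough to contain the midpoint (`modified_mem_rkHalf`). The bounds on holomorphic
functions are reduced to the boundary by the maximum modulus principle.
-/

namespace KernelScheme

/-! ### Symbols of the discrete operators -/

/-- A grid function which the shift by one cell multiplies by `w`: a discrete Fourier mode. All
operators of the scheme are diagonal on such functions, with a symbol depending on `w` only. -/
noncomputable def IsMode {N : ℕ} (w : ℂ) (v : Grid N) : Prop := ∀ i, v (i + 1) = w * v i

/-- The symbol `∑ c_r w^r` of `J^L`. -/
noncomputable def symbolS (α h : ℝ) (w : ℂ) : ℂ := ∑ r ∈ stencil, (quadCoeff α h r : ℂ) * w ^ r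

/-- The symbol of `L_L⁻¹`. The periodic boundary term makes `L_L⁻¹[v]` the periodic solution `x` of
`x_i = e^{-αh} x_{i-1} + J^L_i`, whence the quotient. -/
noncomputable def symbolInv (α h : ℝ) (w : ℂ) : ℂ :=
  symbolS α h w / (1 - (Real.exp (-α * h) : ℂ) * w⁻¹)

variable {N : ℕ} {w : ℂ} {v : Grid N}

theorem IsMode.const_smul (hv : IsMode w v) (a : ℂ) : IsMode w (a • v) := fun i => by
  simp only [Pi.smul_apply, smul_eq_mul, hv i]
  ring

theorem IsMode.add_intCast (hv : IsMode w v) (hw : w ≠ 0) (i : ZMod N) (r : ℤ) :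
    v (i + r) = w ^ r * v i := by
  induction r using Int.induction_on with
  | zero => simp
  | succ n ih =>
    rw [zpow_add_one₀ hw, Int.cast_add, Int.cast_one, ← add_assoc, hv, ih]
    ring
  | pred n ih =>
    have h := hv (i + ((-n - 1 : ℤ) : ZMod N))
    rw [add_assoc, Int.cast_sub, Int.cast_one, sub_add_cancel, ih] at h
    rw [Int.cast_sub, Int.cast_one]
    rw [zpow_sub_one₀ hw, mul_assoc, mul_comm _ (v i), ← mul_assoc, h]
    field_simp

theorem IsMode.JL (hv : IsMode w v) (hw : w ≠ 0) (α h : ℝ) (i : ZMod N) :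
    JL α h v i = symbolS α h w * v i := by
  simp only [KernelScheme.JL, symbolS, Finset.sum_mul, hv.add_intCast hw, mul_assoc]

theorem IsMode.JR (hv : IsMode w v) (hw : w ≠ 0) (α h : ℝ) (i : ZMod N) :
    JR α h v i = symbolS α h w⁻¹ * v i := by
  simp only [KernelScheme.JR, symbolS, Finset.sum_mul, sub_eq_add_neg, ← Int.cast_neg,
    hv.add_intCast hw, mul_assoc, inv_zpow']

theorem one_sub_exp_mul_ne_zero {α h : ℝ} (hα : 0 < α) (hh : 0 < h) (hw : ‖w‖ = 1) :
    1 - (Real.exp (-α * h) : ℂ) * w ≠ 0 := fun h0 => by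
  have := congrArg norm (sub_eq_zero.1 h0)
  rw [norm_one, norm_mul, hw, mul_one, Complex.norm_of_nonneg (Real.exp_pos _).le] at this
  have hlt : Real.exp (-α * h) < 1 := Real.exp_lt_one_iff.2 (by nlinarith [mul_pos hα hh])
  exact hlt.ne this.symm

/-- `I^L` is the periodic solution of its recursion, minus the multiple of the homogeneous solution
that makes it vanish at the left end. -/
theorem IsMode.IL (hv : IsMode w v) (hw : ‖w‖ = 1) {α h : ℝ} (hα : 0 < α) (hh : 0 < h) (n : ℕ) :
    IL α h v n = symbolInv α h w * (v n - (Real.exp (-α * h) : ℂ) ^ n * v 0) := by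
  have hw0 : w ≠ 0 := norm_ne_zero_iff.1 (by rw [hw]; exact one_ne_zero)
  have hS : symbolS α h w = symbolInv α h w * (1 - (Real.exp (-α * h) : ℂ) * w⁻¹) :=
    (div_mul_cancel₀ _ (one_sub_exp_mul_ne_zero hα hh (by rw [norm_inv, hw, inv_one]))).symm
  induction n with
  | zero => simp [KernelScheme.IL]
  | succ n ih =>
    have h1 : v ((n + 1 : ℕ) : ZMod N) = w * v n := by rw [Nat.cast_succ, hv]
    rw [KernelScheme.IL, ih, hv.JL hw0, h1, hS]
    linear_combination -(symbolInv α h w * Real.exp (-α * h) * v n) * inv_mul_cancel₀ hw0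

/-- The mirror image of `IsMode.IL`; the index `n` counts cells from the right end. -/
theorem IsMode.IRrev (hv : IsMode w v) (hw : ‖w‖ = 1) {α h : ℝ} (hα : 0 < α) (hh : 0 < h) (n : ℕ) :
    IRrev α h v n = symbolInv α h w⁻¹ * (v (N - n) - (Real.exp (-α * h) : ℂ) ^ n * v 0) := by
  have hw0 : w ≠ 0 := norm_ne_zero_iff.1 (by rw [hw]; exact one_ne_zero)
  have hS : symbolS α h w⁻¹ = symbolInv α h w⁻¹ * (1 - (Real.exp (-α * h) : ℂ) * w⁻¹⁻¹) :=
    (div_mul_cancel₀ _ (one_sub_exp_mul_ne_zero hα hh (by rw [inv_inv, hw]))).symm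
  induction n with
  | zero => simp [KernelScheme.IRrev]
  | succ n ih =>
    have h1 : v ((N : ZMod N) - n) = w * v (N - ((n + 1 : ℕ) : ZMod N)) := by
      rw [← hv]; congr 1; push_cast; ring
    rw [KernelScheme.IRrev, ih, hv.JR hw0, h1, hS, inv_inv]
    ring

theorem mu_eq (N : ℕ) (α h : ℝ) : (mu N α h : ℂ) = (Real.exp (-α * h) : ℂ) ^ N := by
  rw [mu, ← Complex.ofReal_pow, ← Real.exp_nat_mul]
  congr 2
  ring

theorem one_sub_mu_ne_zero [NeZero N] {α h : ℝ} (hα : 0 < α) (hh : 0 < h) :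
    (1 : ℂ) - mu N α h ≠ 0 := by
  have hlt : mu N α h < 1 := by
    have hN : (0 : ℝ) < N := Nat.cast_pos.2 (NeZero.pos N)
    exact Real.exp_lt_one_iff.2 (by nlinarith [mul_pos hα (mul_pos hN hh)])
  rw [sub_ne_zero]
  exact_mod_cast hlt.ne'

theorem IsMode.invL [NeZero N] (hv : IsMode w v) (hw : ‖w‖ = 1) {α h : ℝ} (hα : 0 < α)
    (hh : 0 < h) :
    invL α h v = symbolInv α h w • v := by
  funext i
  have hmu := one_sub_mu_ne_zero (N := N) hα hh
  rw [mu_eq] at hmu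
  have he : Real.exp (-α * (i.val * h)) = Real.exp (-α * h) ^ i.val := by
    rw [← Real.exp_nat_mul]; congr 1; ring
  rw [KernelScheme.invL, hv.IL hw hα hh, hv.IL hw hα hh, he, ZMod.natCast_self,
    ZMod.natCast_zmod_val, mu_eq, Pi.smul_apply, smul_eq_mul]
  rw [Complex.ofReal_pow]
  generalize (Real.exp (-α * h) : ℂ) = q at hmu ⊢
  field_simp
  ring

theorem IsMode.invR [NeZero N] (hv : IsMode w v) (hw : ‖w‖ = 1) {α h : ℝ} (hα : 0 < α)
    (hh : 0 < h) :
    invR α h v = symbolInv α h w⁻¹ • v := by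
  funext i
  have hmu := one_sub_mu_ne_zero (N := N) hα hh
  rw [mu_eq] at hmu
  have hi : i.val ≤ N := (ZMod.val_lt i).le
  have he : Real.exp (-α * (N * h - i.val * h)) = Real.exp (-α * h) ^ (N - i.val) := by
    rw [← Real.exp_nat_mul, Nat.cast_sub hi]; congr 1; ring
  rw [KernelScheme.invR, IR, IR, hv.IRrev hw hα hh, hv.IRrev hw hα hh, he, Nat.sub_zero, sub_self,
    Nat.cast_sub hi, ZMod.natCast_zmod_val, sub_sub_cancel,
    mu_eq, Pi.smul_apply, smul_eq_mul]
  rw [Complex.ofReal_pow]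
  generalize (Real.exp (-α * h) : ℂ) = q at hmu ⊢
  field_simp
  ring

theorem inv0_eq (α h : ℝ) (v : Grid N) (i : ZMod N) :
    inv0 α h v i = (invL α h v i + invR α h v i) / 2 := by
  simp only [inv0, invL, invR, I0]
  have h0 : IL α h v 0 = 0 := rfl
  have hN : IR α h v N = 0 := by rw [IR, Nat.sub_self]; rfl
  rw [h0, hN]
  ring

/-- Reflection of the grid conjugates the symbol, so `D_R` has the conjugate symbol of `D_L`, and
`D_0` its real part. -/
theorem symbolInv_inv (α h : ℝ) (hw : ‖w‖ = 1) :
    symbolInv α h w⁻¹ = (starRingEnd ℂ) (symbolInv α h w) := by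
  have : w⁻¹ = (starRingEnd ℂ) w := Complex.inv_eq_conj hw
  simp only [symbolInv, symbolS, map_div₀, map_sub, map_one, map_mul, map_sum, map_inv₀, map_zpow₀,
    Complex.conj_ofReal, ← this]

/-- The symbol of `D_L`. -/
noncomputable def symbolD (α h : ℝ) (w : ℂ) : ℂ := 1 - symbolInv α h w

theorem IsMode.DL [NeZero N] (hv : IsMode w v) (hw : ‖w‖ = 1) {α h : ℝ} (hα : 0 < α) (hh : 0 < h) :
    DL α h v = symbolD α h w • v := by
  rw [KernelScheme.DL, hv.invL hw hα hh, symbolD, sub_smul, one_smul]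

theorem IsMode.DR [NeZero N] (hv : IsMode w v) (hw : ‖w‖ = 1) {α h : ℝ} (hα : 0 < α) (hh : 0 < h) :
    DR α h v = (starRingEnd ℂ) (symbolD α h w) • v := by
  rw [KernelScheme.DR, hv.invR hw hα hh, symbolInv_inv _ _ hw, symbolD, map_sub, map_one,
    sub_smul, one_smul]

theorem IsMode.D0 [NeZero N] (hv : IsMode w v) (hw : ‖w‖ = 1) {α h : ℝ} (hα : 0 < α) (hh : 0 < h) :
    D0 α h v = ((symbolD α h w).re : ℂ) • v := by
  funext i
  rw [KernelScheme.D0, Pi.sub_apply, inv0_eq, hv.invL hw hα hh, hv.invR hw hα hh,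
    symbolInv_inv _ _ hw, Complex.re_eq_add_conj, symbolD]
  simp only [Pi.smul_apply, smul_eq_mul, map_sub, map_one]
  ring

theorem iterate_eq_pow_smul {T : Grid N → Grid N} {a : ℂ} (hT : ∀ u, IsMode w u → T u = a • u)
    (hv : IsMode w v) (p : ℕ) : T^[p] v = a ^ p • v := by
  induction p with
  | zero => simp
  | succ p ih =>
    rw [Function.iterate_succ_apply', ih, hT _ (hv.const_smul _), smul_smul, pow_succ']

/-! ### Stability regions of the Runge-Kutta methods -/

/-- The maximum modulus principle for an entire function. -/
theorem norm_le_of_frontier {U : Set ℂ} (hU : Bornology.IsBounded U) {f : ℂ → ℂ}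
    (hf : Differentiable ℂ f) {C : ℝ} (hC : ∀ z ∈ frontier U, ‖f z‖ ≤ C) {z : ℂ}
    (hz : z ∈ closure U) :
    ‖f z‖ ≤ C :=
  Complex.norm_le_of_forall_mem_frontier_norm_le hU hf.diffContOnCl hC hz

theorem norm_one_add_sq_sq (V : ℂ) :
    ‖1 + V ^ 2‖ ^ 2 = (V.re ^ 2 + V.im ^ 2 + 1) ^ 2 - 4 * V.im ^ 2 := by
  rw [← Complex.normSq_eq_norm_sq, Complex.normSq_apply]
  simp [pow_two]
  ring

/-- The region `|1 + V²| ≤ 2` is where `(re V)² + g(im V)² ≤ 1`, for the nonnegative convex function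
`g(t) = √(1 + t²) - 1`. -/
theorem norm_one_add_sq_le_two_iff (V : ℂ) :
    ‖1 + V ^ 2‖ ≤ 2 ↔ V.re ^ 2 + (√(1 + V.im ^ 2) - 1) ^ 2 ≤ 1 := by
  have h2 : √(1 + V.im ^ 2) ^ 2 = 1 + V.im ^ 2 := Real.sq_sqrt (by positivity)
  have h3 := Real.sqrt_nonneg (1 + V.im ^ 2)
  rw [← sq_le_sq₀ (norm_nonneg _) zero_le_two, norm_one_add_sq_sq]
  set s := √(1 + V.im ^ 2)
  have : (V.re ^ 2 + V.im ^ 2 + 1) ^ 2 - 4 * V.im ^ 2 ≤ 2 ^ 2 ↔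
      (V.re ^ 2 + V.im ^ 2 + 1) ^ 2 ≤ (2 * s) ^ 2 := by
    rw [mul_pow, h2]
    constructor <;> intro h <;> linarith
  rw [this, sq_le_sq₀ (by positivity) (by positivity)]
  constructor <;> intro h <;> nlinarith

/-- The Cassini oval `|1 + V²| ≤ 2`, which is the stability region of the second order Runge-Kutta
method in the variable `V = 1 + X`, is convex. -/
theorem convex_cassini : Convex ℝ {V : ℂ | ‖1 + V ^ 2‖ ≤ 2} := by
  intro V hV W hW a b ha hb hab
  simp only [Set.mem_ofPred_eq, norm_one_add_sq_le_two_iff] at hV hW ⊢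
  have hs : ∀ t : ℝ, 1 ≤ √(1 + t ^ 2) := fun t => Real.one_le_sqrt.2 (by nlinarith [sq_nonneg t])
  have hsq : ∀ t : ℝ, √(1 + t ^ 2) ^ 2 = 1 + t ^ 2 := fun t => Real.sq_sqrt (by positivity)
  have hconv : √(1 + (a * V.im + b * W.im) ^ 2) ≤ a * √(1 + V.im ^ 2) + b * √(1 + W.im ^ 2) := by
    -- `√(1 + t²)` is the modulus of `1 + i t`, so this is the triangle inequality.
    have h : ∀ t : ℝ, √(1 + t ^ 2) = ‖(1 + t * Complex.I : ℂ)‖ := fun t => by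
      rw [← Complex.ofReal_one, Complex.norm_add_mul_I, one_pow]
    rw [h, h, h]
    calc ‖(1 + ((a * V.im + b * W.im : ℝ) : ℂ) * Complex.I : ℂ)‖
        = ‖(a : ℂ) * (1 + V.im * Complex.I) + b * (1 + W.im * Complex.I)‖ := by
          congr 1
          have : (a : ℂ) + b = 1 := by exact_mod_cast hab
          push_cast
          linear_combination -this
      _ ≤ _ := by
          refine (norm_add_le _ _).trans (le_of_eq ?_)
          rw [norm_mul, norm_mul, Complex.norm_of_nonneg ha, Complex.norm_of_nonneg hb]
  have h0 := hs (a * V.im + b * W.im)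
  simp only [Complex.add_re, Complex.add_im, Complex.real_smul, Complex.re_ofReal_mul,
    Complex.im_ofReal_mul]
  set s := √(1 + V.im ^ 2)
  set r := √(1 + W.im ^ 2)
  set m := √(1 + (a * V.im + b * W.im) ^ 2)
  obtain rfl : b = 1 - a := by linarith
  have h1 : (m - 1) ^ 2 ≤ (a * (s - 1) + (1 - a) * (r - 1)) ^ 2 :=
    pow_le_pow_left₀ (by linarith) (by linarith) 2
  nlinarith [mul_nonneg (mul_nonneg ha hb) (sq_nonneg (s - r)),
    mul_nonneg (mul_nonneg ha hb) (sq_nonneg (V.re - W.re)), mul_le_mul_of_nonneg_left hV ha,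
    mul_le_mul_of_nonneg_left hW hb]

theorem mem_closedBall_half {z : ℂ} :
    z ∈ Metric.closedBall (1 / 2 : ℂ) (1 / 2) ↔ z.im ^ 2 ≤ z.re - z.re ^ 2 := by
  rw [mem_closedBall_iff_norm, ← sq_le_sq₀ (norm_nonneg _) (by norm_num),
    ← Complex.normSq_eq_norm_sq, Complex.normSq_apply]
  norm_num
  constructor <;> intro h <;> nlinarith

/-- On the boundary circle, with `p = re z`, the square of the left side is
`4 + p²(p - 1)(17p + 15)`. -/
theorem norm_one_add_sq_le_two_of_mem {z : ℂ} (hz : z ∈ Metric.closedBall (1 / 2 : ℂ) (1 / 2)) :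
    ‖1 + (1 - (z + z ^ 2)) ^ 2‖ ≤ 2 := by
  rw [← closure_ball _ (by norm_num)] at hz
  refine norm_le_of_frontier Metric.isBounded_ball (f := fun z => 1 + (1 - (z + z ^ 2)) ^ 2)
    (by fun_prop) (fun w hw => ?_) hz
  rw [frontier_ball _ (by norm_num), mem_sphere_iff_norm] at hw
  have hw' : w.im ^ 2 = w.re - w.re ^ 2 := by
    have := congrArg (· ^ 2) hw
    simp only [← Complex.normSq_eq_norm_sq, Complex.normSq_apply] at this
    norm_num at this
    linarith
  rw [← sq_le_sq₀ (norm_nonneg _) (by norm_num), norm_one_add_sq_sq]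
  obtain ⟨p, q⟩ := w
  dsimp only at hw'
  have hp : 0 ≤ p := by nlinarith
  have hp1 : p ≤ 1 := by nlinarith
  have hre : (1 - ((⟨p, q⟩ : ℂ) + (⟨p, q⟩ : ℂ) ^ 2)).re = 1 - 2 * p ^ 2 := by
    simp [pow_two]
    linarith
  have him : (1 - ((⟨p, q⟩ : ℂ) + (⟨p, q⟩ : ℂ) ^ 2)).im ^ 2 = (p - p ^ 2) * (1 + 2 * p) ^ 2 := by
    rw [← hw']
    simp [pow_two]
    ring
  rw [him, hre]
  nlinarith [mul_nonneg (mul_nonneg (sq_nonneg p) (sub_nonneg.2 hp1))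
    (by positivity : 0 ≤ 17 * p + 15)]

/-- A convex set containing `[0, 3]` such that `X = -(67/80) W` is in the stability region of the
third order Runge-Kutta method for all `W` in it; `67/80 = 0.8375` is twice the largest admitted
`β`. The end point `3` corresponds to `X = -2.5125`, very near to the end of the real
stability interval, so the disc has to be centred close to the middle of `[0, 3]` for its boundary to be curved enough
there. -/
def rkHalf : Set ℂ := {W | 0 ≤ W.re} ∩ Metric.closedBall (7 / 5) (8 / 5)

/-- On the part of the boundary in the imaginary axis the squared modulus is
`1 - Y²/12 + Y³/36` with `Y = (im X)²`; on the arc of the circle it is a cubic polynomial in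
`re W`. -/
theorem norm_rk3_frontier_le {W : ℂ} (hre : 0 ≤ W.re)
    (hb : ‖W - 7 / 5‖ ≤ 8 / 5) (h : W.re = 0 ∨ ‖W - 7 / 5‖ = 8 / 5) (X : ℂ)
    (hX : X = -((67 / 80 : ℝ) * W)) :
    ‖1 + X + X ^ 2 / 2 + X ^ 3 / 6‖ ≤ 1 := by
  have key : ‖1 + X + X ^ 2 / 2 + X ^ 3 / 6‖ ^ 2 =
      (1 + X.re + (X.re ^ 2 - X.im ^ 2) / 2 + (X.re ^ 3 - 3 * X.re * X.im ^ 2) / 6) ^ 2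
      + X.im ^ 2 * (1 + X.re + (3 * X.re ^ 2 - X.im ^ 2) / 6) ^ 2 := by
    rw [← Complex.normSq_eq_norm_sq, Complex.normSq_apply]
    simp [pow_succ]
    ring
  rw [← sq_le_one_iff₀ (norm_nonneg _), key, hX]
  have e : ∀ W : ℂ, ‖W - 7 / 5‖ ^ 2 = (W.re - 7 / 5) ^ 2 + W.im ^ 2 := fun W => by
    rw [← Complex.normSq_eq_norm_sq, Complex.normSq_apply]
    norm_num
    ring
  obtain ⟨p, q⟩ := W
  simp only [Complex.neg_re, Complex.neg_im, Complex.re_ofReal_mul, Complex.im_ofReal_mul]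
  dsimp only at hre h
  rcases h with rfl | h
  · have h2 : ‖(⟨0, q⟩ : ℂ) - 7 / 5‖ ^ 2 ≤ (8 / 5) ^ 2 := pow_le_pow_left₀ (norm_nonneg _) hb 2
    rw [e] at h2
    norm_num at h2
    have hY : (-(67 / 80 * q)) ^ 2 ≤ 3 := by nlinarith
    have hY0 := sq_nonneg (-(67 / 80 * q))
    generalize (-(67 / 80 * q)) ^ 2 = Y at *
    nlinarith [mul_nonneg (sq_nonneg Y) (sub_nonneg.2 hY)]
  · have h2 := e ⟨p, q⟩
    rw [h] at h2
    dsimp only at h2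
    have hq : (-(67 / 80 * q)) ^ 2 = (67 / 80) ^ 2 * ((8 / 5) ^ 2 - (p - 7 / 5) ^ 2) := by
      rw [h2]
      ring
    have hp3 : p ≤ 3 := by nlinarith [sq_nonneg q]
    rw [hq]
    nlinarith [mul_nonneg hre (sq_nonneg (3 - p)), mul_nonneg hre (sub_nonneg.2 hp3)]

theorem norm_rk3_le_of_mem {W : ℂ} (hW : W ∈ rkHalf) (X : ℂ) (hX : X = -((67 / 80 : ℝ) * W)) :
    ‖1 + X + X ^ 2 / 2 + X ^ 3 / 6‖ ≤ 1 := by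
  subst hX
  obtain ⟨hre, hb⟩ := hW
  rw [Set.mem_ofPred_eq] at hre
  rw [mem_closedBall_iff_norm] at hb
  by_cases h : W.re = 0 ∨ ‖W - 7 / 5‖ = 8 / 5
  · exact norm_rk3_frontier_le hre hb h _ rfl
  push Not at h
  set U : Set ℂ := {W | 0 < W.re} ∩ Metric.ball (7 / 5) (8 / 5)
  have hU : IsOpen U := (isOpen_lt continuous_const Complex.continuous_re).inter Metric.isOpen_ball
  have hcl : closure U ⊆ rkHalf := by
    refine closure_minimal ?_ ((isClosed_le continuous_const Complex.continuous_re).inter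
      Metric.isClosed_closedBall)
    exact Set.inter_subset_inter (fun w hw => le_of_lt (Set.mem_ofPred.1 hw))
      Metric.ball_subset_closedBall
  refine norm_le_of_frontier (U := U) (Metric.isBounded_ball.subset Set.inter_subset_right)
    (f := fun W => 1 + -((67 / 80 : ℝ) * W) + (-((67 / 80 : ℝ) * W)) ^ 2 / 2
      + (-((67 / 80 : ℝ) * W)) ^ 3 / 6) (by fun_prop) (fun w hw => ?_)
    (subset_closure ⟨lt_of_le_of_ne hre (Ne.symm h.1), mem_ball_iff_norm.2 (lt_of_le_of_ne hb h.2)⟩)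
  rw [hU.frontier_eq] at hw
  obtain ⟨h1, h2⟩ := hcl hw.1
  rw [Set.mem_ofPred_eq] at h1
  rw [mem_closedBall_iff_norm] at h2
  refine norm_rk3_frontier_le h1 h2 ?_ _ rfl
  by_contra! hne
  exact hw.2 ⟨lt_of_le_of_ne h1 (Ne.symm hne.1), mem_ball_iff_norm.2 (lt_of_le_of_ne h2 hne.2)⟩

theorem convex_rkHalf : Convex ℝ rkHalf :=
  (convex_halfSpace_re_ge 0).inter (convex_closedBall _ _)


/-- Stability for order one: `-(β (z + y))` is a convex combination of `0`, `-2z` and `-2y`. -/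
theorem norm_rk1_le {z : ℂ} (hz : z ∈ Metric.closedBall (1 / 2 : ℂ) (1 / 2)) {y β : ℝ} (hy0 : 0 ≤ y)
    (hy1 : y ≤ 1) (hβ0 : 0 ≤ β) (hβ : β ≤ 1) : ‖1 + -(β * (z + y) : ℂ)‖ ≤ 1 := by
  have hz' : ‖1 - 2 * z‖ ≤ 1 := by
    rw [mem_closedBall_iff_norm'] at hz
    calc ‖1 - 2 * z‖ = ‖(2 : ℂ) * (1 / 2 - z)‖ := by ring_nf
      _ ≤ 2 * (1 / 2) := by rw [norm_mul, Complex.norm_two]; gcongr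
      _ = 1 := by norm_num
  have hy : ‖(1 - 2 * y : ℂ)‖ ≤ 1 := by
    have : (1 - 2 * y : ℂ) = ((1 - 2 * y : ℝ) : ℂ) := by push_cast; rfl
    rw [this, Complex.norm_real, Real.norm_eq_abs, abs_le]
    constructor <;> linarith
  have hball := convex_closedBall (0 : ℂ) 1
  simp only [← mem_closedBall_zero_iff] at hz' hy ⊢
  have hmid := hball hz' hy (a := 1 / 2) (b := 1 / 2) (by norm_num) (by norm_num) (by norm_num)
  convert hball (by simp : (1 : ℂ) ∈ _) hmid (sub_nonneg.2 hβ) hβ0 (by ring) using 1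
  simp only [Complex.real_smul]
  push_cast
  ring

/-- In the variable `V = 1 + X` the amplification factor is `(1 + V²) / 2`, and `V` is a convex
combination of `1`, `1 - A` and `1 - Y`, where `A = z + z²` and `Y = y + y²`. -/
theorem norm_rk2_le {z : ℂ} (hz : z ∈ Metric.closedBall (1 / 2 : ℂ) (1 / 2)) {y β : ℝ} (hy0 : 0 ≤ y)
    (hy1 : y ≤ 1) (hβ0 : 0 ≤ β) (hβ : β ≤ 1 / 2) (X : ℂ)
    (hX : X = -(β * (z + z ^ 2 + (y + y ^ 2)))) : ‖1 + X + X ^ 2 / 2‖ ≤ 1 := by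
  have h1 : (1 : ℂ) ∈ {V : ℂ | ‖1 + V ^ 2‖ ≤ 2} := by
    rw [Set.mem_ofPred_eq]
    norm_num
  have hy : (1 - (y + y ^ 2) : ℂ) ∈ {V : ℂ | ‖1 + V ^ 2‖ ≤ 2} := by
    have e : (1 + (1 - (y + y ^ 2)) ^ 2 : ℂ) = ((1 + (1 - (y + y ^ 2)) ^ 2 : ℝ) : ℂ) := by
      push_cast
      rfl
    rw [Set.mem_ofPred_eq, e, Complex.norm_of_nonneg (by positivity)]
    have h1 : 0 ≤ y + y ^ 2 := by positivity
    have h2 : y + y ^ 2 ≤ 2 := by linarith [pow_le_one₀ hy0 hy1 (n := 2)]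
    nlinarith
  have hmid := convex_cassini (norm_one_add_sq_le_two_of_mem hz) hy (a := 1 / 2) (b := 1 / 2)
    (by norm_num) (by norm_num) (by norm_num)
  have h := convex_cassini h1 hmid (a := 1 - 2 * β) (b := 2 * β) (by linarith)
    (by linarith) (by ring)
  have e : 1 + X + X ^ 2 / 2 = (1 + (1 + X) ^ 2) / 2 := by ring
  rw [e, norm_div, Complex.norm_two, div_le_one two_pos]
  have hV : 1 + X = (1 - 2 * β) • (1 : ℂ)
      + (2 * β) • ((1 / 2 : ℝ) • (1 - (z + z ^ 2)) + (1 / 2 : ℝ) • (1 - (y + y ^ 2) : ℂ)) := by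
    rw [hX]
    simp only [Complex.real_smul]
    push_cast
    ring
  rw [hV]
  exact h

/-- The left side is a monotone function of `t`, and the right side is its value at `p - p²`. -/
theorem sub_mul_sq_le {p t : ℝ} (hp : 0 ≤ p) (ht0 : 0 ≤ t) (ht : t ≤ p - p ^ 2) :
    t * (1 + 2 * p + 5 * p ^ 2 - t) ^ 2 ≤ (p - p ^ 2) * (1 + p + 6 * p ^ 2) ^ 2 := by
  have hT : p - p ^ 2 ≤ 1 / 4 := by nlinarith [sq_nonneg (p - 1 / 2)]
  obtain ⟨T, hT'⟩ : ∃ T, T = p - p ^ 2 := ⟨_, rfl⟩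
  obtain ⟨M, hM'⟩ : ∃ M, M = 1 + 2 * p + 5 * p ^ 2 := ⟨_, rfl⟩
  have hM : 1 ≤ M := by rw [hM']; nlinarith
  rw [show 1 + p + 6 * p ^ 2 = M - T by rw [hM', hT']; ring, ← hT', ← hM']
  rw [← hT'] at hT ht
  have : 0 ≤ M ^ 2 - 2 * M * (T + t) + (T ^ 2 + T * t + t ^ 2) := by
    have : 0 ≤ M * (M - 2 * (T + t)) := mul_nonneg (by linarith) (by linarith)
    nlinarith [mul_nonneg ht0 (ht0.trans ht), sq_nonneg T, sq_nonneg t]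
  nlinarith [mul_nonneg (sub_nonneg.2 ht) this]

/-- Bounds the squared imaginary part of the modified third partial sum at a point of the disc with
real part `p`. -/
theorem im_sq_bound_le {p : ℝ} (hp : 0 ≤ p) (hp1 : p ≤ 1) :
    (p - p ^ 2) * (1 + p + 6 * p ^ 2) ^ 2 ≤ 27 / 5 := by
  nlinarith [mul_nonneg hp (sub_nonneg.2 hp1), sq_nonneg (p ^ 3 - 4 / 5 * p ^ 2),
    sq_nonneg (p ^ 2 - 4 / 5 * p), sq_nonneg (p - 4 / 5),
    mul_nonneg hp (sq_nonneg (p ^ 2 - 4 / 5 * p)), mul_nonneg hp (sq_nonneg (p - 4 / 5)),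
    mul_nonneg (sub_nonneg.2 hp1) (sq_nonneg (p - 4 / 5)),
    mul_nonneg (sub_nonneg.2 hp1) (sq_nonneg (p ^ 2 - 4 / 5 * p))]

/-- Used for `(7/5 - re W)² + (im W)²`, if `re W ≤ 7/5` and `W` is the midpoint of the modified
third partial sum and a nonnegative number. -/
theorem re_sq_add_im_sq_bound_le {p : ℝ} (hp : 0 ≤ p) :
    (7 / 5 - p ^ 3) ^ 2 + (p - p ^ 2) * (1 + p + 6 * p ^ 2) ^ 2 / 4 ≤ 64 / 25 := by
  nlinarith [sq_nonneg (p ^ 3 - 4 / 5 * p ^ 2), sq_nonneg (p ^ 2 - 4 / 5 * p),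
    sq_nonneg (p - 4 / 5), mul_nonneg hp (sq_nonneg (p ^ 2 - 2 / 3 * p)),
    mul_nonneg hp (sq_nonneg (p - 2 / 3))]

/-- The modified third partial sum (symbol `z + z² + z³ - re z z'²`) has real part at least
`2 (re z)³`, thanks to the extra term; its midpoint with any `Y ∈ [0, 3]` lies in `rkHalf`. -/
theorem modified_mem_rkHalf {z z' : ℂ} (hz : z ∈ Metric.closedBall (1 / 2 : ℂ) (1 / 2))
    (hz' : z' = z ∨ z' = (starRingEnd ℂ) z) {Y : ℝ} (hY0 : 0 ≤ Y) (hY : Y ≤ 3) :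
    (z + z ^ 2 + z ^ 3 - z.re * z' ^ 2 + Y) / 2 ∈ rkHalf := by
  rw [mem_closedBall_half] at hz
  obtain ⟨p, q⟩ := z
  dsimp only at hz
  have hq := sq_nonneg q
  have hp : 0 ≤ p := by nlinarith
  have hp1 : p ≤ 1 := by nlinarith
  obtain ⟨A, hA⟩ : ∃ A : ℂ, A = ⟨p, q⟩ + (⟨p, q⟩ : ℂ) ^ 2 + (⟨p, q⟩ : ℂ) ^ 3 - (p : ℝ) * z' ^ 2 :=
    ⟨_, rfl⟩
  have hre : A.re = p + p ^ 2 - q ^ 2 - 2 * p * q ^ 2 := by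
    rcases hz' with rfl | rfl <;> simp [hA, pow_succ] <;> ring
  have him : A.im ^ 2 ≤ q ^ 2 * (1 + 2 * p + 5 * p ^ 2 - q ^ 2) ^ 2 := by
    rcases hz' with rfl | rfl
    · have : A.im = q * (1 + 2 * p + p ^ 2 - q ^ 2) := by simp [hA, pow_succ]; ring
      rw [this, mul_pow]
      have : 0 ≤ 1 + 2 * p + p ^ 2 - q ^ 2 := by nlinarith
      gcongr
      nlinarith
    · have : A.im = q * (1 + 2 * p + 5 * p ^ 2 - q ^ 2) := by simp [hA, pow_succ]; ring
      rw [this, mul_pow]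
  have hlow : 2 * p ^ 3 ≤ A.re := by rw [hre]; nlinarith [mul_nonneg hp (sub_nonneg.2 hz)]
  have hup : A.re ≤ 2 := by rw [hre]; nlinarith [mul_nonneg hp hq]
  have hB := him.trans (sub_mul_sq_le hp hq hz)
  have hp3 : 0 ≤ p ^ 3 := by positivity
  rw [← hA]
  have e1 : ((A + Y) / 2).re = (A.re + Y) / 2 := by simp
  have e2 : ((A + Y) / 2).im = A.im / 2 := by simp
  refine ⟨?_, ?_⟩
  · rw [Set.mem_ofPred_eq, e1]
    linarith
  · rw [mem_closedBall_iff_norm, ← sq_le_sq₀ (norm_nonneg _) (by norm_num),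
      ← Complex.normSq_eq_norm_sq, Complex.normSq_apply, Complex.sub_re, Complex.sub_im, e1, e2]
    norm_num
    rcases le_or_gt ((A.re + Y) / 2) (7 / 5) with h | h
    · have hs : (7 / 5 - (A.re + Y) / 2) ^ 2 ≤ (7 / 5 - p ^ 3) ^ 2 :=
        pow_le_pow_left₀ (by linarith) (by linarith) 2
      linarith [re_sq_add_im_sq_bound_le hp]
    · have hs : ((A.re + Y) / 2 - 7 / 5) ^ 2 ≤ (11 / 10) ^ 2 :=
        pow_le_pow_left₀ (by linarith) (by linarith) 2
      linarith [im_sq_bound_le hp hp1]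

/-- `X` is `-(67/80)` times a convex combination of `0` and the midpoint of the two partial sums. -/
theorem norm_rk3_le {z z' : ℂ} (hz : z ∈ Metric.closedBall (1 / 2 : ℂ) (1 / 2))
    (hz' : z' = z ∨ z' = (starRingEnd ℂ) z) {y β : ℝ} (hy0 : 0 ≤ y) (hy1 : y ≤ 1)
    (hβ0 : 0 ≤ β) (hβ : β ≤ 67 / 160) (X : ℂ)
    (hX : X = -(β * (z + z ^ 2 + z ^ 3 - z.re * z' ^ 2 + (y + y ^ 2 + y ^ 3)))) :
    ‖1 + X + X ^ 2 / 2 + X ^ 3 / 6‖ ≤ 1 := by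
  have h0 : (0 : ℂ) ∈ rkHalf := by
    refine ⟨Set.mem_ofPred.2 Complex.zero_re.ge, ?_⟩
    rw [mem_closedBall_iff_norm, zero_sub, norm_neg]
    norm_num
  have hY : y + y ^ 2 + y ^ 3 ≤ 3 := by
    linarith [pow_le_one₀ hy0 hy1 (n := 2), pow_le_one₀ hy0 hy1 (n := 3)]
  have h := convex_rkHalf h0 (modified_mem_rkHalf hz hz' (by positivity) hY)
    (a := 1 - 160 / 67 * β) (b := 160 / 67 * β) (by linarith) (by linarith) (by ring)
  refine norm_rk3_le_of_mem h X ?_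
  rw [hX]
  simp only [Complex.real_smul]
  push_cast
  ring

/-! ### Location of the symbols -/

/-- The moments `∫ (1/4 - t²)^k e^{νt} dt` over the unit cell centred at the origin. -/
noncomputable def evenMoment (ν : ℝ) (k : ℕ) : ℝ :=
  ∫ t in (-(1 / 2))..(1 / 2), (1 / 4 - t ^ 2) ^ k * Real.exp (ν * t)

/-- The moments `∫ t (1/4 - t²)^k e^{νt} dt` over the unit cell centred at the origin. -/
noncomputable def oddMoment (ν : ℝ) (k : ℕ) : ℝ :=
  ∫ t in (-(1 / 2))..(1 / 2), t * (1 / 4 - t ^ 2) ^ k * Real.exp (ν * t)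

theorem evenMoment_nonneg (ν : ℝ) (k : ℕ) : 0 ≤ evenMoment ν k := by
  refine intervalIntegral.integral_nonneg (by norm_num) fun t ht => ?_
  have : 0 ≤ 1 / 4 - t ^ 2 := by nlinarith [ht.1, ht.2]
  positivity

/-- Integration by parts against `e^{νt}`; every relation between the moments is an instance. -/
theorem integral_deriv_add_mul_exp (ν : ℝ) {P P' : ℝ → ℝ} (hP : ∀ t, HasDerivAt P (P' t) t)
    (hP' : Continuous P') :
    ∫ t in (-(1 / 2))..(1 / 2), (P' t + ν * P t) * Real.exp (ν * t)
      = P (1 / 2) * Real.exp (ν / 2) - P (-(1 / 2)) * Real.exp (-(ν / 2)) := by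
  have hc : Continuous P := continuous_iff_continuousAt.2 fun t => (hP t).continuousAt
  have h := intervalIntegral.integral_eq_sub_of_hasDerivAt (a := -(1 / 2)) (b := 1 / 2)
    (f := fun t => P t * Real.exp (ν * t)) (f' := fun t => (P' t + ν * P t) * Real.exp (ν * t))
    (fun t _ => ((hP t).fun_mul ((hasDerivAt_id t).const_mul ν).exp).congr_deriv
      (by simp only [id]; ring)) (Continuous.intervalIntegrable (by fun_prop) _ _)
  rw [h]
  ring_nf

theorem mul_evenMoment_zero (ν : ℝ) :
    ν * evenMoment ν 0 = Real.exp (ν / 2) - Real.exp (-(ν / 2)) := by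
  have h := integral_deriv_add_mul_exp ν (fun t => hasDerivAt_const t (1 : ℝ)) continuous_const
  rw [one_mul, one_mul] at h
  rw [← h, evenMoment, ← intervalIntegral.integral_const_mul]
  congr 1
  ext t
  ring

theorem integral_moments (ν a₀ a₁ a₂ b₀ b₁ b₂ : ℝ) :
    ∫ t in (-(1 / 2))..(1 / 2), (a₀ + a₁ * (1 / 4 - t ^ 2) + a₂ * (1 / 4 - t ^ 2) ^ 2
      + t * (b₀ + b₁ * (1 / 4 - t ^ 2) + b₂ * (1 / 4 - t ^ 2) ^ 2)) * Real.exp (ν * t)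
      = a₀ * evenMoment ν 0 + a₁ * evenMoment ν 1 + a₂ * evenMoment ν 2
        + (b₀ * oddMoment ν 0 + b₁ * oddMoment ν 1 + b₂ * oddMoment ν 2) := by
  simp only [evenMoment, oddMoment, ← intervalIntegral.integral_const_mul]
  have hi : ∀ f : ℝ → ℝ, Continuous f →
      IntervalIntegrable f MeasureTheory.volume (-(1 / 2)) (1 / 2) := fun f hf =>
    hf.intervalIntegrable _ _
  repeat rw [← intervalIntegral.integral_add (hi _ (by fun_prop)) (hi _ (by fun_prop))]
  congr 1
  ext t
  ring

theorem two_mul_oddMoment (ν : ℝ) (k : ℕ) :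
    2 * (k + 1) * oddMoment ν k = ν * evenMoment ν (k + 1) := by
  have h := integral_deriv_add_mul_exp ν (P := fun t => (1 / 4 - t ^ 2) ^ (k + 1))
    (P' := fun t => (k + 1) * (1 / 4 - t ^ 2) ^ k * (-(2 * t))) 
    (fun t => (((hasDerivAt_pow 2 t).const_sub (1 / 4)).fun_pow (k + 1)).congr_deriv
      (by push_cast; ring_nf)) (by fun_prop)
  rw [show (1 / 4 - (1 / 2) ^ 2 : ℝ) = 0 by norm_num,
    show (1 / 4 - (-(1 / 2)) ^ 2 : ℝ) = 0 by norm_num,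
    zero_pow k.succ_ne_zero, zero_mul, zero_mul, sub_zero] at h
  rw [oddMoment, evenMoment, ← intervalIntegral.integral_const_mul,
    ← intervalIntegral.integral_const_mul, eq_comm, ← sub_eq_zero,
    ← intervalIntegral.integral_sub (Continuous.intervalIntegrable (by fun_prop) _ _)
      (Continuous.intervalIntegrable (by fun_prop) _ _), ← h]
  congr 1
  ext t
  ring

/-- With `two_mul_oddMoment` this is the three-term recurrence of the even moments. -/
theorem evenMoment_rec (ν : ℝ) (k : ℕ) :
    (2 * k + 3) * evenMoment ν (k + 1) + ν * oddMoment ν (k + 1)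
      = (k + 1) / 2 * evenMoment ν k := by
  have h := integral_deriv_add_mul_exp ν (P := fun t => t * (1 / 4 - t ^ 2) ^ (k + 1))
    (P' := fun t => (1 / 4 - t ^ 2) ^ (k + 1) + t * ((k + 1) * (1 / 4 - t ^ 2) ^ k * (-(2 * t))))
    (fun t => ((hasDerivAt_id t).fun_mul
      (((hasDerivAt_pow 2 t).const_sub (1 / 4)).fun_pow (k + 1))).congr_deriv
      (by simp only [id]; push_cast; ring_nf)) (by fun_prop)
  rw [show (1 / 4 - (1 / 2) ^ 2 : ℝ) = 0 by norm_num,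
    show (1 / 4 - (-(1 / 2)) ^ 2 : ℝ) = 0 by norm_num,
    zero_pow k.succ_ne_zero] at h
  simp only [mul_zero, zero_mul, sub_zero] at h
  have hi : ∀ f : ℝ → ℝ, Continuous f →
      IntervalIntegrable f MeasureTheory.volume (-(1 / 2)) (1 / 2) := fun f hf =>
    hf.intervalIntegrable _ _
  simp only [evenMoment, oddMoment, ← intervalIntegral.integral_const_mul]
  rw [← sub_eq_zero, ← intervalIntegral.integral_add (hi _ (by fun_prop)) (hi _ (by fun_prop)),
    ← intervalIntegral.integral_sub (hi _ (by fun_prop)) (hi _ (by fun_prop)), ← h]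
  congr 1
  ext t
  ring

theorem exp_add_exp_eq (ν : ℝ) :
    Real.exp (ν / 2) + Real.exp (-(ν / 2)) = 2 * evenMoment ν 0 + ν ^ 2 * evenMoment ν 1 := by
  have h := integral_deriv_add_mul_exp ν (P := fun t => 2 * t) (P' := fun _ => 2) (fun t => by
      simpa using (hasDerivAt_id t).const_mul (2 : ℝ)) continuous_const
  have h2 := integral_moments ν 2 0 0 (2 * ν) 0 0
  have h3 := two_mul_oddMoment ν 0
  norm_num at h2 h3 h
  have h4 : ∫ t in (-(1 / 2))..(1 / 2), (2 + ν * (2 * t)) * Real.exp (ν * t) =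
    ∫ t in (-(1 / 2))..(1 / 2), (2 + t * (2 * ν)) * Real.exp (ν * t) := by
    congr 1; ext t; ring
  norm_num at h4
  linear_combination -h + h4 + h2 + ν * h3

/-- A quadrature coefficient in terms of the moments with `ν = αh`, read off from the expansion of
the Lagrange basis polynomial in powers of `1/4 - t²`, `t` being the signed distance to the cell
midpoint in units of `h`. -/
theorem quadCoeff_eq {α h : ℝ} (hh : h ≠ 0) (r : ℤ) (a₀ a₁ a₂ b₀ b₁ b₂ : ℝ)
    (hr : ∀ t : ℝ, (Lagrange.basis stencil (fun j : ℤ => (j : ℝ)) r).eval (t - 1 / 2) =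
      a₀ + a₁ * (1 / 4 - t ^ 2) + a₂ * (1 / 4 - t ^ 2) ^ 2
      + t * (b₀ + b₁ * (1 / 4 - t ^ 2) + b₂ * (1 / 4 - t ^ 2) ^ 2)) :
    quadCoeff α h r = α * h * Real.exp (-(α * h / 2)) *
      (a₀ * evenMoment (α * h) 0 + a₁ * evenMoment (α * h) 1 + a₂ * evenMoment (α * h) 2
        + (b₀ * oddMoment (α * h) 0 + b₁ * oddMoment (α * h) 1 + b₂ * oddMoment (α * h) 2)) := by
  have hs := intervalIntegral.mul_integral_comp_mul_sub (a := -(1 / 2)) (b := 1 / 2) (c := h)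
    (d := h / 2) (f := fun s => Real.exp (α * s)
      * (Lagrange.basis stencil (fun j : ℤ => (j : ℝ)) r).eval (s / h))
  rw [show h * -(1 / 2) - h / 2 = -h by ring, show h * (1 / 2) - h / 2 = 0 by ring] at hs
  rw [quadCoeff, ← hs, ← integral_moments, mul_assoc α, mul_assoc α, mul_assoc h,
    ← intervalIntegral.integral_const_mul (Real.exp _)]
  congr 3
  ext t
  rw [show (h * t - h / 2) / h = t - 1 / 2 by field_simp, hr,
    show α * (h * t - h / 2) = -(α * h / 2) + α * h * t by ring, Real.exp_add]
  ring

theorem eval_basis_stencil (r : ℤ) (x : ℝ) :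
    (Lagrange.basis stencil (fun j : ℤ => (j : ℝ)) r).eval x =
      ∏ j ∈ stencil.erase r, ((r - j : ℝ)⁻¹ * (x - j)) := by
  simp [Lagrange.basis, Lagrange.basisDivisor, Polynomial.eval_prod]

theorem stencil_eq : stencil = {-3, -2, -1, 0, 1, 2} := by rw [stencil]; decide

/-- The numerator of the symbol, for `w = ζ²` and `ζ = e^{iθ/2}`. The stencil is symmetric about the
midpoint of the cell, so the interpolant of the mode splits into an even part, a multiple of
`c = cos (θ/2)`, and an odd part, a multiple of `s = i sin (θ/2)`. -/
theorem symbolS_sq_mul {α h : ℝ} (hh : h ≠ 0) {ζ : ℂ} (hζ : ζ ≠ 0) {c s : ℂ}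
    (hc : c = (ζ + ζ⁻¹) / 2) (hs : s = (ζ - ζ⁻¹) / 2) :
    symbolS α h (ζ ^ 2) * ζ = (α * h * Real.exp (-(α * h / 2)) : ℝ) *
      (c * (evenMoment (α * h) 0 - 2 * s ^ 2 * evenMoment (α * h) 1
          + 2 / 3 * s ^ 4 * (2 * evenMoment (α * h) 1 + evenMoment (α * h) 2))
        + s * (2 * oddMoment (α * h) 0 - 4 / 3 * s ^ 2 * oddMoment (α * h) 1
          + 4 / 15 * s ^ 4 * (2 * oddMoment (α * h) 1 + oddMoment (α * h) 2))) := by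
  have h1 := quadCoeff_eq (α := α) hh (-3) 0 (1 / 24) (1 / 48) 0 (-1 / 60) (-1 / 120) fun t => by
    rw [eval_basis_stencil, show stencil.erase (-3) = {-2, -1, 0, 1, 2} by rw [stencil]; decide]
    simp
    ring
  have h2 := quadCoeff_eq (α := α) hh (-2) 0 (-3 / 8) (-1 / 16) 0 (1 / 4) (1 / 24) fun t => by
    rw [eval_basis_stencil, show stencil.erase (-2) = {-3, -1, 0, 1, 2} by rw [stencil]; decide]
    simp
    ring
  have h3 := quadCoeff_eq (α := α) hh (-1) (1 / 2) (1 / 3) (1 / 24) (-1) (-2 / 3) (-1 / 12)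
      fun t => by
    rw [eval_basis_stencil, show stencil.erase (-1) = {-3, -2, 0, 1, 2} by rw [stencil]; decide]
    simp
    ring
  have h4 := quadCoeff_eq (α := α) hh 0 (1 / 2) (1 / 3) (1 / 24) 1 (2 / 3) (1 / 12) fun t => by
    rw [eval_basis_stencil, show stencil.erase 0 = {-3, -2, -1, 1, 2} by rw [stencil]; decide]
    simp
    ring
  have h5 := quadCoeff_eq (α := α) hh 1 0 (-3 / 8) (-1 / 16) 0 (-1 / 4) (-1 / 24) fun t => by
    rw [eval_basis_stencil, show stencil.erase 1 = {-3, -2, -1, 0, 2} by rw [stencil]; decide]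
    simp
    ring
  have h6 := quadCoeff_eq (α := α) hh 2 0 (1 / 24) (1 / 48) 0 (1 / 60) (1 / 120) fun t => by
    rw [eval_basis_stencil, show stencil.erase 2 = {-3, -2, -1, 0, 1} by rw [stencil]; decide]
    simp
    ring
  have hsum : symbolS α h (ζ ^ 2) * ζ = quadCoeff α h (-3) * (ζ⁻¹) ^ 5
      + quadCoeff α h (-2) * (ζ⁻¹) ^ 3
      + quadCoeff α h (-1) * ζ⁻¹ + quadCoeff α h 0 * ζ + quadCoeff α h 1 * ζ ^ 3
      + quadCoeff α h 2 * ζ ^ 5 := by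
    rw [symbolS, stencil_eq]
    simp [zpow_neg, zpow_ofNat]
    field_simp
    ring
  rw [hsum, h1, h2, h3, h4, h5, h6, hc, hs]
  generalize evenMoment (α * h) 0 = A₀
  generalize evenMoment (α * h) 1 = A₁
  generalize evenMoment (α * h) 2 = A₂
  generalize oddMoment (α * h) 0 = B₀
  generalize oddMoment (α * h) 1 = B₁
  generalize oddMoment (α * h) 2 = B₂
  generalize α * h * Real.exp (-(α * h / 2)) = C
  push_cast
  field_simp
  ring

theorem one_sub_div_mem_closedBall {n d : ℂ} (h : Complex.normSq n ≤ n.re * d.re + n.im * d.im)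
    (hd : d ≠ 0) : 1 - n / d ∈ Metric.closedBall (1 / 2 : ℂ) (1 / 2) := by
  have e : 1 - n / d - 1 / 2 = (d / 2 - n) / d := by field_simp; ring
  rw [mem_closedBall_iff_norm, e, norm_div, div_le_iff₀ (norm_pos_iff.2 hd),
    ← sq_le_sq₀ (norm_nonneg _) (by positivity), mul_pow, ← Complex.normSq_eq_norm_sq,
    ← Complex.normSq_eq_norm_sq]
  rw [Complex.normSq_apply] at h
  simp only [Complex.normSq_apply, Complex.sub_re, Complex.sub_im, Complex.div_ofNat_re,
    Complex.div_ofNat_im]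
  linarith

/-- The polynomial inequality behind `symbolD_mem_closedBall`, with `x = sin² (θ/2)`, `σ = ν²` and
`A₀, …, A₃` the even moments. Once `A₀`, `A₁` are eliminated by the recurrence, the terms of order
`x` and `x²` cancel, and the rest is `x³` times an expression that is visibly nonnegative. -/
theorem dissipation_nonneg {A₂ A₃ σ x : ℝ} (h2 : 0 ≤ A₂) (h3 : 0 ≤ A₃) (hσ : 0 ≤ σ) (hx0 : 0 ≤ x)
    (hx1 : x ≤ 1) {A₀ A₁ : ℝ} (hA0 : A₀ = 6 * A₁ + σ * A₂ / 2) (hA1 : A₁ = 5 * A₂ + σ * A₃ / 6) :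
    0 ≤ (1 - x) * ((A₀ + 2 * x * A₁ + 2 / 3 * x ^ 2 * (2 * A₁ + A₂)) *
        (A₀ - (A₀ + 2 * x * A₁ + 2 / 3 * x ^ 2 * (2 * A₁ + A₂))))
      + x * ((A₁ + x * A₂ / 3 + 4 / 15 * x ^ 2 * (A₂ / 2 + A₃ / 6)) *
        (2 * A₀ + σ * A₁ - σ * (A₁ + x * A₂ / 3 + 4 / 15 * x ^ 2 * (A₂ / 2 + A₃ / 6)))) := by
  have hx2 : x ^ 2 ≤ 1 := pow_le_one₀ hx0 hx1
  -- The left side of the claim divided by `x³`.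
  have key : 0 ≤ (544 / 3 * A₂ ^ 2 + 514 / 45 * σ * A₂ * A₃ + 8 / 45 * σ ^ 2 * A₃ ^ 2
        + 8 / 3 * A₂ * A₃ + 4 / 45 * σ ^ 2 * A₂ * A₃)
      + x * (836 / 9 * A₂ ^ 2 + 272 / 45 * σ * A₂ * A₃ + 8 / 81 * σ ^ 2 * A₃ ^ 2)
      + x ^ 2 * (484 / 9 * A₂ ^ 2 + 2192 / 675 * σ * A₂ * A₃ + 4 / 81 * σ ^ 2 * A₃ ^ 2)
      + σ * A₂ ^ 2 * (656 / 225 + 4 / 45 * (1 - x) + 4 / 225 * (1 - x ^ 2))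
      + σ * A₃ ^ 2 * (176 / 2025 + 4 / 2025 * (1 - x ^ 2)) := by
    have := sub_nonneg.2 hx1
    have := sub_nonneg.2 hx2
    positivity
  have := mul_nonneg (pow_nonneg hx0 3) key
  subst hA1 hA0
  linear_combination this

/-- The denominator of the symbol, in the moments that also express the numerator. -/
theorem one_sub_exp_mul_inv_sq (ν : ℝ) {ζ : ℂ} (hζ : ζ ≠ 0) {c s : ℂ}
    (hc : c = (ζ + ζ⁻¹) / 2) (hs : s = (ζ - ζ⁻¹) / 2) :
    (1 - (Real.exp (-ν) : ℂ) * (ζ ^ 2)⁻¹) * ζ = Real.exp (-(ν / 2)) *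
      (c * (ν * evenMoment ν 0) + s * (2 * evenMoment ν 0 + ν ^ 2 * evenMoment ν 1)) := by
  have h1 : (Real.exp (ν / 2) : ℂ) * Real.exp (-(ν / 2)) = 1 := by
    rw [← Complex.ofReal_mul, ← Real.exp_add, add_neg_cancel, Real.exp_zero, Complex.ofReal_one]
  have hq : (Real.exp (-ν) : ℂ) = Real.exp (-(ν / 2)) * Real.exp (-(ν / 2)) := by
    rw [← Complex.ofReal_mul, ← Real.exp_add]
    congr 2
    ring
  have hE : (2 * evenMoment ν 0 + ν ^ 2 * evenMoment ν 1 : ℂ)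
      = Real.exp (ν / 2) + Real.exp (-(ν / 2)) := by exact_mod_cast (exp_add_exp_eq ν).symm
  have hE' : (ν * evenMoment ν 0 : ℂ) = Real.exp (ν / 2) - Real.exp (-(ν / 2)) := by
    exact_mod_cast mul_evenMoment_zero ν
  rw [hE, hE', hc, hs, hq]
  generalize (Real.exp (ν / 2) : ℂ) = a at *
  generalize (Real.exp (-(ν / 2)) : ℂ) = b at *
  field_simp
  linear_combination (-2 * ζ ^ 2) * h1

/-- The symbol of `L_L⁻¹` as a quotient in which the common factor `e^{-ν/2} ζ⁻¹` is cancelled. -/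
theorem symbolInv_sq {α h : ℝ} (hh : h ≠ 0) {ζ : ℂ} (hζ : ζ ≠ 0) {c s : ℂ}
    (hc : c = (ζ + ζ⁻¹) / 2) (hs : s = (ζ - ζ⁻¹) / 2) {ν : ℝ} (hν : ν = α * h) :
    symbolInv α h (ζ ^ 2) =
      (c * (ν * (evenMoment ν 0 - 2 * s ^ 2 * evenMoment ν 1
          + 2 / 3 * s ^ 4 * (2 * evenMoment ν 1 + evenMoment ν 2)))
        + s * (ν ^ 2 * (evenMoment ν 1 - s ^ 2 * evenMoment ν 2 / 3
          + 4 / 15 * s ^ 4 * (evenMoment ν 2 / 2 + evenMoment ν 3 / 6))))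
      / (c * (ν * evenMoment ν 0) + s * (2 * evenMoment ν 0 + ν ^ 2 * evenMoment ν 1)) := by
  have hB : ∀ k : ℕ, (oddMoment ν k : ℂ) = ν * evenMoment ν (k + 1) / (2 * (k + 1)) := fun k => by
    rw [eq_div_iff (by exact_mod_cast (by positivity : (2 * (k + 1) : ℝ) ≠ 0)), mul_comm]
    exact_mod_cast two_mul_oddMoment ν k
  have he : (Real.exp (-(ν / 2)) : ℂ) ≠ 0 := Complex.ofReal_ne_zero.2 (Real.exp_ne_zero _)
  rw [symbolInv, ← mul_div_mul_right (symbolS _ _ _) _ hζ, symbolS_sq_mul hh hζ hc hs, ← hν,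
    neg_mul, ← hν, one_sub_exp_mul_inv_sq ν hζ hc hs, Complex.ofReal_mul, mul_comm (ν : ℂ),
    mul_assoc,
    mul_div_mul_left _ _ he, hB, hB, hB]
  congr 1
  push_cast
  ring

/-- The symbol of `D_L` stays in the disc with diameter `[0, 1]`, whose boundary circle
contains the values `iω / (1 + iω)` of the symbol of the exact operator. -/
theorem symbolD_mem_closedBall {α h : ℝ} (hα : 0 < α) (hh : 0 < h) {w : ℂ} (hw : ‖w‖ = 1) :
    symbolD α h w ∈ Metric.closedBall (1 / 2 : ℂ) (1 / 2) := by
  obtain ⟨ζ, rfl⟩ := IsAlgClosed.exists_pow_nat_eq w two_pos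
  have hζ1 : ‖ζ‖ = 1 :=
    (pow_eq_one_iff_of_nonneg (norm_nonneg ζ) two_ne_zero).1 (by rwa [norm_pow] at hw)
  have hζ : ζ ≠ 0 := norm_ne_zero_iff.1 (by rw [hζ1]; exact one_ne_zero)
  have hinv : ζ⁻¹ = (starRingEnd ℂ) ζ := Complex.inv_eq_conj hζ1
  have hc : (ζ.re : ℂ) = (ζ + ζ⁻¹) / 2 := by rw [hinv, Complex.re_eq_add_conj]
  have hs : (ζ.im * Complex.I : ℂ) = (ζ - ζ⁻¹) / 2 := by
    rw [hinv, Complex.im_eq_sub_conj]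
    field_simp
  obtain ⟨ν, hν⟩ : ∃ ν, ν = α * h := ⟨_, rfl⟩
  have hden := one_sub_exp_mul_inv_sq ν hζ hc hs
  have hd0 := mul_ne_zero (one_sub_exp_mul_ne_zero (w := (ζ ^ 2)⁻¹) hα hh
    (by rw [norm_inv, hw, inv_one])) hζ
  rw [neg_mul, ← hν, hden] at hd0
  rw [symbolD, symbolInv_sq hh.ne' hζ hc hs hν]
  refine one_sub_div_mem_closedBall ?_ (right_ne_zero_of_mul hd0)
  have hcs : ζ.re ^ 2 = 1 - ζ.im ^ 2 := by
    have := Complex.sq_norm_sub_sq_im ζ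
    rw [hζ1] at this
    linarith
  have hA0 := evenMoment_rec ν 0
  have hA1 := evenMoment_rec ν 1
  have hB1 := two_mul_oddMoment ν 1
  have hB2 := two_mul_oddMoment ν 2
  norm_num at hA0 hA1 hB1 hB2
  have hT := mul_nonneg (sq_nonneg ν) (dissipation_nonneg (evenMoment_nonneg ν 2)
    (evenMoment_nonneg ν 3) (sq_nonneg ν) (sq_nonneg ζ.im) (by nlinarith [sq_nonneg ζ.re])
    (A₀ := evenMoment ν 0) (A₁ := evenMoment ν 1)
    (by linear_combination 2 * ν / 4 * hB1 + (-2) * hA0)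
    (by linear_combination ν / 6 * hB2 - hA1))
  generalize evenMoment ν 0 = A₀ at *
  generalize evenMoment ν 1 = A₁ at *
  generalize evenMoment ν 2 = A₂ at *
  generalize evenMoment ν 3 = A₃ at *
  rw [← hcs] at hT
  have hn : ((ζ.re : ℂ) * (ν * (A₀ - 2 * (ζ.im * Complex.I) ^ 2 * A₁
          + 2 / 3 * (ζ.im * Complex.I) ^ 4 * (2 * A₁ + A₂)))
        + (ζ.im * Complex.I) * (ν ^ 2 * (A₁ - (ζ.im * Complex.I) ^ 2 * A₂ / 3
          + 4 / 15 * (ζ.im * Complex.I) ^ 4 * (A₂ / 2 + A₃ / 6)))) =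
     ⟨ζ.re * (ν * (A₀ + 2 * ζ.im ^ 2 * A₁ + 2 / 3 * (ζ.im ^ 2) ^ 2 * (2 * A₁ + A₂))),
      ζ.im * (ν ^ 2 * (A₁ + ζ.im ^ 2 * A₂ / 3 + 4 / 15 * (ζ.im ^ 2) ^ 2 * (A₂ / 2 + A₃ / 6)))⟩ := by
    have hI4 : Complex.I ^ 4 = 1 := Complex.I_pow_four
    rw [Complex.mk_eq_add_mul_I, mul_pow, mul_pow, Complex.I_sq, hI4]
    push_cast
    ring
  have hd : (ζ.re : ℂ) * (ν * A₀) + ζ.im * Complex.I * (2 * A₀ + ν ^ 2 * A₁) =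
      ⟨ζ.re * (ν * A₀), ζ.im * (2 * A₀ + ν ^ 2 * A₁)⟩ := by
    rw [Complex.mk_eq_add_mul_I]
    push_cast
    ring
  rw [hn, hd, Complex.normSq_mk]
  linear_combination hT

/-! ### Amplification of Fourier modes -/

theorem isMode_mode [NeZero N] {xl xr : ℝ} (hx : xl < xr) (m : ℤ) :
    IsMode (Complex.exp (2 * Real.pi * m / N * Complex.I)) (mode N xl xr m) := by
  have hN : (N : ℂ) ≠ 0 := Nat.cast_ne_zero.2 (NeZero.ne N)
  have hL : ((xr : ℂ) - xl) ≠ 0 := by exact_mod_cast (sub_pos.2 hx).ne'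
  -- The mode is the same geometric progression for every representative `n` of an index.
  have hmode : ∀ n : ℕ, mode N xl xr m (n : ZMod N) =
      Complex.exp (Complex.I * (2 * Real.pi * m / (xr - xl) * xl))
      * Complex.exp (2 * Real.pi * m / N * Complex.I) ^ n := fun n => by
    rw [mode, ← Complex.exp_nat_mul, ← Complex.exp_add, ZMod.val_natCast,
      Complex.exp_eq_exp_iff_exists_int]
    obtain ⟨a, ha⟩ : ∃ a : ℕ, ((n % N : ℕ) : ℂ) = n - N * a :=
      ⟨n / N, eq_sub_of_add_eq (by exact_mod_cast Nat.mod_add_div n N)⟩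
    refine ⟨-(m * a), ?_⟩
    push_cast
    rw [ha]
    field_simp
    ring
  intro i
  rw [← ZMod.natCast_zmod_val i, ← Nat.cast_succ, hmode, hmode, pow_succ]
  ring

/-- The convection terms act on modes through a single point `z` of the disc, the symbol of `D_L` if
`c > 0` and of `D_R` if `c < 0`; if `c < 0`, the point `z'` depends on the side `s`. For `c = 0` the
terms vanish, and `z = 0` serves. -/
theorem convection_symbol [NeZero N] {c β dt h : ℝ} (hβ : 0 < β) (hdt : 0 < dt) (hh : 0 < h)
    (hw : ‖w‖ = 1) (s : Side) :
    ∃ z ∈ Metric.closedBall (1 / 2 : ℂ) (1 / 2), ∃ z' : ℂ, (z' = z ∨ z' = (starRingEnd ℂ) z) ∧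
      ∀ v : Grid N, IsMode w v → ∀ i,
        (∀ k, (dt : ℂ) * (-((β / (|c| * dt) : ℝ) : ℂ) *
            ∑ p ∈ Finset.Icc 1 k, (DL (alphaC c β dt) h)^[p] (fPlus c v) i
          + ((β / (|c| * dt) : ℝ) : ℂ) *
            ∑ p ∈ Finset.Icc 1 k, (DR (alphaC c β dt) h)^[p] (fMinus c v) i)
          = -(β * ∑ p ∈ Finset.Icc 1 k, z ^ p) * v i) ∧
        (dt : ℂ) * (((β / (|c| * dt) : ℝ) : ℂ) * D0 (alphaC c β dt) h
          ((DL (alphaC c β dt) h)^[2] (fPlus c v)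
            - (DSide s (alphaC c β dt) h)^[2] (fMinus c v)) i)
          = β * (z.re * z' ^ 2) * v i := by
  rcases eq_or_ne c 0 with rfl | hc
  · refine ⟨0, by rw [mem_closedBall_half]; simp, 0, Or.inl rfl, fun v hv i => ⟨fun k => ?_, ?_⟩⟩
    · have : ∑ p ∈ Finset.Icc 1 k, (0 : ℂ) ^ p = 0 := Finset.sum_eq_zero fun p hp =>
        zero_pow (by have := (Finset.mem_Icc.1 hp).1; omega)
      simp [this]
    · simp
  have hc' : 0 < |c| := abs_pos.2 hc
  have hα : 0 < alphaC c β dt := div_pos hβ (mul_pos hc' hdt)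
  have hcoef : (dt : ℂ) * ((β / (|c| * dt) : ℝ) : ℂ) * (|c| : ℝ) = β := by
    rw [← Complex.ofReal_mul, ← Complex.ofReal_mul]
    congr 1
    field_simp
  set α := alphaC c β dt
  set d := symbolD α h w
  have hd : d ∈ Metric.closedBall (1 / 2 : ℂ) (1 / 2) := symbolD_mem_closedBall hα hh hw
  have hdc : (starRingEnd ℂ) d ∈ Metric.closedBall (1 / 2 : ℂ) (1 / 2) := by
    rw [mem_closedBall_half] at hd ⊢
    simpa using hd
  have hDL : ∀ u : Grid N, IsMode w u → ∀ p, (DL α h)^[p] u = d ^ p • u := fun u hu p =>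
    iterate_eq_pow_smul (fun _ hu' => hu'.DL hw hα hh) hu p
  have hDR : ∀ u : Grid N, IsMode w u → ∀ p, (DR α h)^[p] u = (starRingEnd ℂ) d ^ p • u :=
    fun u hu p =>
    iterate_eq_pow_smul (fun _ hu' => hu'.DR hw hα hh) hu p
  have hp : ∀ v : Grid N, fPlus c v = (((c + |c|) / 2 : ℝ) : ℂ) • v := fun v => by
    funext i
    simp only [fPlus, Pi.smul_apply, smul_eq_mul]
    push_cast
    ring
  have hm : ∀ v : Grid N, fMinus c v = (((c - |c|) / 2 : ℝ) : ℂ) • v := fun v => by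
    funext i
    simp only [fMinus, Pi.smul_apply, smul_eq_mul]
    push_cast
    ring
  obtain ⟨e, he, hside⟩ : ∃ e, (e = d ∨ e = (starRingEnd ℂ) d) ∧ ∀ u : Grid N, IsMode w u →
      (DSide s α h)^[2] u = e ^ 2 • u := by
    cases s
    · exact ⟨d, Or.inl rfl, fun u hu => hDL u hu 2⟩
    · exact ⟨_, Or.inr rfl, fun u hu => hDR u hu 2⟩
  have hpart : ∀ v : Grid N, IsMode w v → ∀ (k : ℕ) (i),
      (dt : ℂ) * (-((β / (|c| * dt) : ℝ) : ℂ) * ∑ p ∈ Finset.Icc 1 k, (DL α h)^[p] (fPlus c v) i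
          + ((β / (|c| * dt) : ℝ) : ℂ) * ∑ p ∈ Finset.Icc 1 k, (DR α h)^[p] (fMinus c v) i)
      = (dt : ℂ) * ((β / (|c| * dt) : ℝ) : ℂ) *
        (-(((c + |c|) / 2 : ℝ) : ℂ) * ∑ p ∈ Finset.Icc 1 k, d ^ p
        + (((c - |c|) / 2 : ℝ) : ℂ) * ∑ p ∈ Finset.Icc 1 k, (starRingEnd ℂ) d ^ p) * v i := by
    intro v hv k i
    simp only [hp, hm, hDL _ (hv.const_smul _), hDR _ (hv.const_smul _), Pi.smul_apply, smul_eq_mul,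
      ← Finset.sum_mul]
    ring
  have hext : ∀ v : Grid N, IsMode w v → ∀ i, (dt : ℂ) * (((β / (|c| * dt) : ℝ) : ℂ) * D0 α h
          ((DL α h)^[2] (fPlus c v) - (DSide s α h)^[2] (fMinus c v)) i) =
       (dt : ℂ) * ((β / (|c| * dt) : ℝ) : ℂ) * d.re * ((((c + |c|) / 2 : ℝ) : ℂ) * d ^ 2
        - (((c - |c|) / 2 : ℝ) : ℂ) * e ^ 2) * v i := by
    intro v hv i
    have : (DL α h)^[2] (fPlus c v) - (DSide s α h)^[2] (fMinus c v) =
      ((((c + |c|) / 2 : ℝ) : ℂ) * d ^ 2 - (((c - |c|) / 2 : ℝ) : ℂ) * e ^ 2) • v := by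
      rw [hp, hm, hDL _ (hv.const_smul _), hside _ (hv.const_smul _), smul_smul, smul_smul,
        ← sub_smul]
      ring_nf
    rw [this, (hv.const_smul _).D0 hw hα hh]
    simp only [Pi.smul_apply, smul_eq_mul]
    ring
  rcases hc.lt_or_gt with hneg | hpos
  · have h1 : (c + |c|) / 2 = 0 := by rw [abs_of_neg hneg]; ring
    have h2 : (c - |c|) / 2 = -|c| := by rw [abs_of_neg hneg]; ring
    refine ⟨(starRingEnd ℂ) d, hdc, e, ?_, fun v hv i => ⟨fun k => ?_, ?_⟩⟩
    · rw [Complex.conj_conj]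
      exact he.symm
    · rw [hpart v hv, h1, h2, ← hcoef]
      push_cast
      ring
    · rw [hext v hv, h1, h2, ← hcoef, Complex.conj_re]
      push_cast
      ring
  · have h1 : (c + |c|) / 2 = |c| := by rw [abs_of_pos hpos]; ring
    have h2 : (c - |c|) / 2 = 0 := by rw [abs_of_pos hpos]; ring
    refine ⟨d, hd, d, Or.inl rfl, fun v hv i => ⟨fun k => ?_, ?_⟩⟩
    · rw [hpart v hv, h1, h2, ← hcoef]
      push_cast
      ring
    · rw [hext v hv, h1, h2, ← hcoef]
      push_cast
      ring

/-- The diffusion term acts on modes through a real number `y ∈ [0, 1]`, the symbol of `D_0`, or `0`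
if `b = 0`. -/
theorem diffusion_symbol [NeZero N] {b β dt h : ℝ} (hb : 0 ≤ b) (hβ : 0 < β) (hdt : 0 < dt)
    (hh : 0 < h) (hw : ‖w‖ = 1) :
    ∃ y : ℝ, 0 ≤ y ∧ y ≤ 1 ∧ ∀ v : Grid N, IsMode w v → ∀ k i,
      (dt : ℂ) * (((β / (b * dt) : ℝ) : ℂ) *
        ∑ p ∈ Finset.Icc 1 k, (D0 (alphaD b β dt) h)^[p] (gDiff b v) i)
      = (β * ∑ p ∈ Finset.Icc 1 k, (y : ℂ) ^ p) * v i := by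
  rcases hb.eq_or_lt with rfl | hb
  · refine ⟨0, le_rfl, zero_le_one, fun v hv k i => ?_⟩
    have : ∑ p ∈ Finset.Icc 1 k, ((0 : ℝ) : ℂ) ^ p = 0 := Finset.sum_eq_zero fun p hp => by
      rw [Complex.ofReal_zero, zero_pow (by have := (Finset.mem_Icc.1 hp).1; omega)]
    rw [this]
    simp
  have hα : 0 < alphaD b β dt := Real.sqrt_pos.2 (div_pos hβ (mul_pos hb hdt))
  have hd := symbolD_mem_closedBall hα hh hw
  rw [mem_closedBall_half] at hd
  have hsq := sq_nonneg (symbolD (alphaD b β dt) h w).im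
  refine ⟨(symbolD (alphaD b β dt) h w).re, by nlinarith, by nlinarith, fun v hv k i => ?_⟩
  have hg : gDiff b v = (b : ℂ) • v := rfl
  have hcoef : (dt : ℂ) * ((β / (b * dt) : ℝ) : ℂ) * b = β := by
    rw [← Complex.ofReal_mul, ← Complex.ofReal_mul]
    congr 1
    field_simp
  have hD0 : ∀ p, (D0 (alphaD b β dt) h)^[p] ((b : ℂ) • v) =
      ((symbolD (alphaD b β dt) h w).re : ℂ) ^ p • (b : ℂ) • v := fun p =>
    iterate_eq_pow_smul (fun _ hu' => hu'.D0 hw hα hh) (hv.const_smul _) p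
  simp only [hg, hD0, Pi.smul_apply, smul_eq_mul, ← Finset.sum_mul]
  rw [← hcoef]
  ring

/-- If `Δt H` multiplies modes by `X`, a Runge-Kutta step multiplies them by the Taylor polynomial
of `exp X`. -/
theorem sspRK_eq_smul {dt : ℝ} {H : Grid N → Grid N} {X : ℂ}
    (hH : ∀ u, IsMode w u → (dt : ℂ) • H u = X • u) (hv : IsMode w v) :
    sspRK 1 dt H v = (1 + X) • v ∧ sspRK 2 dt H v = (1 + X + X ^ 2 / 2) • v ∧
      sspRK 3 dt H v = (1 + X + X ^ 2 / 2 + X ^ 3 / 6) • v := by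
  have hE : ∀ u, IsMode w u → euler dt H u = (1 + X) • u := fun u hu => by
    rw [euler, hH u hu, add_smul, one_smul]
  have h1 := hE v hv
  have h2 : euler dt H ((1 + X) • v) = ((1 + X) ^ 2) • v := by
    rw [hE _ (hv.const_smul _), smul_smul, sq]
  refine ⟨h1, ?_, ?_⟩
  · simp only [sspRK, h1, h2, smul_smul, ← add_smul]
    congr 1
    ring
  · simp only [sspRK, h1, h2, smul_smul, ← add_smul, hE _ (hv.const_smul _)]
    congr 1
    ring

end KernelScheme

open KernelScheme in
theorem mainTheorem4 (k : ℕ) (hk : k = 1 ∨ k = 2 ∨ k = 3) (s : KernelScheme.Side)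
    (c b β : ℝ) (hb : 0 ≤ b) (hβ : 0 < β) (hβmax : β ≤ KernelScheme.betaMax k) :
    KernelScheme.UnconditionallyStable k s c b β := by
  intro xl xr hx N hN dt hdt m
  have : NeZero N := ⟨hN.ne'⟩
  have hh : 0 < (xr - xl) / N := div_pos (sub_pos.2 hx) (Nat.cast_pos.2 hN)
  have hv := isMode_mode (N := N) hx m
  have hw : ‖Complex.exp (2 * Real.pi * m / N * Complex.I)‖ = 1 := by
    rw [← Complex.norm_exp_ofReal_mul_I (2 * Real.pi * m / N)]
    push_cast
    rfl
  obtain ⟨z, hz, z', hz', hconv⟩ := convection_symbol (N := N) (c := c) hβ hdt hh hw s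
  obtain ⟨y, hy0, hy1, hdiff⟩ := diffusion_symbol (N := N) hb hβ hdt hh hw
  have hpart : ∀ (k : ℕ) (u : Grid N), IsMode (Complex.exp (2 * Real.pi * m / N * Complex.I)) u →
      (dt : ℂ) • partialSum k c b β dt ((xr - xl) / N) u =
        (-(β * (∑ p ∈ Finset.Icc 1 k, z ^ p + ∑ p ∈ Finset.Icc 1 k, (y : ℂ) ^ p))) • u := by
    intro k u hu
    funext i
    simp only [Pi.smul_apply, smul_eq_mul, partialSum]
    linear_combination (hconv u hu i).1 k - hdiff u hu k i
  rcases hk with rfl | rfl | rfl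
  · have hH := sspRK_eq_smul (hpart 1) hv
    refine ⟨_, hH.1, ?_⟩
    norm_num [betaMax, beta1Max, beta2Max] at hβmax
    simpa using norm_rk1_le hz hy0 hy1 hβ.le hβmax
  · have hH := sspRK_eq_smul (hpart 2) hv
    refine ⟨_, hH.2.1, ?_⟩
    norm_num [betaMax, beta1Max, beta2Max] at hβmax
    refine norm_rk2_le hz hy0 hy1 hβ.le (by linarith) _ ?_
    simp [Finset.sum_Icc_succ_top]
  · have hmod : ∀ u : Grid N, IsMode (Complex.exp (2 * Real.pi * m / N * Complex.I)) u →
      (dt : ℂ) • modifiedSum s c b β dt ((xr - xl) / N) u =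
        (-(β * (z + z ^ 2 + z ^ 3 - z.re * z' ^ 2 + (y + y ^ 2 + y ^ 3)))) • u := by
      intro u hu
      funext i
      have h1 := congrFun (hpart 3 u hu) i
      have h2 := (hconv u hu i).2
      simp only [Finset.sum_Icc_succ_top, Finset.Icc_self, Finset.sum_singleton, Pi.smul_apply,
        smul_eq_mul, modifiedSum, Nat.reduceLeDiff, Nat.reduceAdd, pow_one] at h1 ⊢
      linear_combination h1 + h2
    have hH := sspRK_eq_smul hmod hv
    refine ⟨_, hH.2.2, ?_⟩
    norm_num [betaMax, beta1Max, beta2Max] at hβmax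
    exact norm_rk3_le hz hz' hy0 hy1 hβ.le (by linarith) _ rfl
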